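/- Let $M$ be a compact smooth manifold of dimension $d\ge 2$ with nonempty boundary $N=\partial M$, let $E\to M$ and $F_1,\dots,F_k\to N$ be smooth complex vector bundles of finite rank, and let $A\colon C^\infty(E)\to C^\infty(E)$ be a linear differential operator of order (at most) $\omega>0$. For $1\le j\le k$ let $B_0^j,B_1^j\colon C^\infty(E)\to C^\infty(F_j)$ be boundary differential operators with $\operatorname{ord}B_0^j<\operatorname{ord}B_1^j<\omega$. For $t\in\mathbb R$ put $B_t=(B_t^1,\dots,B_t^k)$ with $B_t^j=(1-t)B_0^j+tB_1^j$, put $\omega_j(t)=\operatorname{ord}B_t^j$, and let $B'=B_1-B_0$. Let $H^s$ denote the $L^2$-based Sobolev spaces of sections. Assume that for every $0\le t\le 1$ the boundary problem $(A,B_t)$ is invertible, i.e. that its extension by continuity $$(A,B_t)\colon H^\omega(E)\to L^2(E)\oplus\bigoplus_{j=1}^k H^{\omega-\omega_j(t)-1/2}(F_j)$$ is bijective. Let $A_t$ be the operator $A$ with domain $\ker B_t\subset H^\omega(E)$, and let $\operatorname{spec}(A_t)$ be the set of $z\in\mathbb C$ for which $A_t-z\colon\ker B_t\to L^2(E)$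 is not bijective. Then for $0\le t\le1$ and $z\notin\operatorname{spec}(A_t)$ the operator $(A-z,B_t)$ between the above spaces is bijective, so that the resolvent operator $R_t(z)\colon L^2(E)\to H^\omega(E)$, $R_t(z)u=(A-z,B_t)^{-1}(u,0)$, and the Poisson operator $P_t(z)\colon\bigoplus_jH^{\omega-\omega_j(t)-1/2}(F_j)\to H^\omega(E)$, $P_t(z)f=(A-z,B_t)^{-1}(0,f)$, are well-defined bounded operators, and, with derivatives taken in the operator norm: 1. for every $0<t\le1$ and $z\notin\operatorname{spec}(A_t)$, the map $\tau\mapsto R_\tau(z)$ (given by the same formula for all real $\tau$ near $t$) is differentiable at $\tau=t$, and $$\partial_tR_t(z)=-P_t(z)\,B'\,R_t(z);$$ 2. for every $0\le t\le1$ and $z\notin\operatorname{spec}(A_t)$, the map $\zeta\mapsto P_t(\zeta)$ is complex differentiable at $\zeta=z$, and $$\partial_zP_t(z)=R_t(z)\,P_t(z),$$ where on the right $P_t(z)f\in H^\omega(E)$ is regarded as an element of $L^2(E)$. -/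

import Mathlib

open Set MeasureTheory Bundle Manifold
open scoped ContDiff Topology

set_option linter.unusedSectionVars false
set_option linter.unusedSimpArgs false

noncomputable section

namespace BVP

/-! ### Smooth sections of complex vector bundles

A smooth complex vector bundle over a real manifold is a bundle `V` whose trivializations are
`ℂ`-linear on the fibres (`VectorBundle ℂ F V`) and whose transition functions are smooth over `ℝ`
(`VectorBundle ℝ F V` and `ContMDiffVectorBundle ∞ F V I`). -/

section Sections

variable {E : Type*} [NormedAddCommGroup E] [NormedSpace ℝ E]
  {H : Type*} [TopologicalSpace H] (I : ModelWithCorners ℝ E H)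
  {M : Type*} [TopologicalSpace M] [ChartedSpace H M]
  (F : Type*) [NormedAddCommGroup F] [NormedSpace ℂ F]
  (V : M → Type*) [TopologicalSpace (TotalSpace F V)] [∀ x, TopologicalSpace (V x)]
  [∀ x, AddCommGroup (V x)] [∀ x, Module ℂ (V x)]
  [FiberBundle F V] [VectorBundle ℝ F V] [VectorBundle ℂ F V]

/-- The complex vector space `C^∞(V)` of smooth sections of `V`. -/
def SmoothSections : Submodule ℂ (∀ x, V x) where
  carrier := {s | ContMDiff I (I.prod 𝓘(ℝ, F)) ∞ fun x => TotalSpace.mk' F x (s x)}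
  add_mem' hs ht := ContMDiff.add_section hs ht
  zero_mem' := contMDiff_zeroSection ℝ V
  smul_mem' c s hs := by
    intro x₀
    have h := (contMDiffAt_section x₀).1 (hs x₀)
    refine (contMDiffAt_section x₀).2 ?_
    set e := trivializationAt F V x₀
    have h2 := ((c • ContinuousLinearMap.id ℝ F).contMDiff (n := ∞)).contMDiffAt.comp x₀ h
    refine h2.congr_of_eventuallyEq ?_
    filter_upwards [e.open_baseSet.mem_nhds (mem_baseSet_trivializationAt F V x₀)] with x hx
    exact (e.linear ℂ hx).2 c (s x)

variable {I F V}

/-- Multiplication of smooth sections by a smooth real function. -/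
def mulFun (f : C^∞⟮I, M; 𝓘(ℝ, ℝ), ℝ⟯) : SmoothSections I F V →ₗ[ℂ] SmoothSections I F V where
  toFun s := ⟨fun x => f x • s.1 x, ContMDiff.smul_section f.contMDiff s.2⟩
  map_add' s t := by ext x; exact smul_add _ _ _
  map_smul' c s := by ext x; exact smul_comm _ _ _

end Sections

/-! ### Differential operators -/

section DiffOp

variable {E : Type*} [NormedAddCommGroup E] [NormedSpace ℝ E]
  {H : Type*} [TopologicalSpace H] {I : ModelWithCorners ℝ E H}
  {M : Type*} [TopologicalSpace M] [ChartedSpace H M]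
  {F : Type*} [NormedAddCommGroup F] [NormedSpace ℂ F]
  {V : M → Type*} [TopologicalSpace (TotalSpace F V)] [∀ x, TopologicalSpace (V x)]
  [∀ x, AddCommGroup (V x)] [∀ x, Module ℂ (V x)]
  [FiberBundle F V] [VectorBundle ℝ F V] [VectorBundle ℂ F V]
  {E' : Type*} [NormedAddCommGroup E'] [NormedSpace ℝ E']
  {H' : Type*} [TopologicalSpace H'] {J : ModelWithCorners ℝ E' H'}
  {N : Type*} [TopologicalSpace N] [ChartedSpace H' N]
  {G : Type*} [NormedAddCommGroup G] [NormedSpace ℂ G]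
  {W : N → Type*} [TopologicalSpace (TotalSpace G W)] [∀ x, TopologicalSpace (W x)]
  [∀ x, AddCommGroup (W x)] [∀ x, Module ℂ (W x)]
  [FiberBundle G W] [VectorBundle ℝ G W] [VectorBundle ℂ G W]

/-- The commutator `[B, f] = B ∘ f - (f ∘ ι) ∘ B` of an operator `B : C^∞(M; V) → C^∞(N; W)` with
multiplication by a smooth function `f` on `M`, which acts on sections over `N` through
`ι : N → M`. -/
def commutator (ι : C^∞⟮J, N; I, M⟯) (f : C^∞⟮I, M; 𝓘(ℝ, ℝ), ℝ⟯)
    (B : SmoothSections I F V →ₗ[ℂ] SmoothSections J G W) :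
    SmoothSections I F V →ₗ[ℂ] SmoothSections J G W :=
  B ∘ₗ mulFun f - mulFun (f.comp ι) ∘ₗ B

/-- `B : C^∞(M; V) → C^∞(N; W)` is a differential operator of order at most `m` along
`ι : N → M`, in Grothendieck's sense: all its `(m + 1)`-fold commutators with smooth functions on
`M` vanish. Equivalently, `(B u)(x)` is in local coordinates a linear combination, with smooth
coefficients, of the partial derivatives of `u` of order at most `m` at `ι x`.
For `ι = id` these are the differential operators on `M`; for the inclusion `ι` of the boundary
`N = ∂M` these are the boundary differential operators. -/
def IsDiffOp (ι : C^∞⟮J, N; I, M⟯) :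
    ℕ → (SmoothSections I F V →ₗ[ℂ] SmoothSections J G W) → Prop
  | 0, B => ∀ f, commutator ι f B = 0
  | m + 1, B => ∀ f, IsDiffOp ι m (commutator ι f B)

/-- The order of a differential operator. -/
def diffOrder (ι : C^∞⟮J, N; I, M⟯)
    (B : SmoothSections I F V →ₗ[ℂ] SmoothSections J G W) : ℕ :=
  sInf {m | IsDiffOp ι m B}

end DiffOp

/-! ### Sobolev spaces of sections over a compact manifold -/

section Sobolev

variable {E : Type*} [NormedAddCommGroup E] [InnerProductSpace ℝ E] [FiniteDimensional ℝ E]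
  [MeasurableSpace E] [BorelSpace E]
  {H : Type*} [TopologicalSpace H] (I : ModelWithCorners ℝ E H)
  {M : Type*} [TopologicalSpace M] [ChartedSpace H M]
  (F : Type*) [NormedAddCommGroup F] [NormedSpace ℂ F]
  (V : M → Type*) [TopologicalSpace (TotalSpace F V)] [∀ x, TopologicalSpace (V x)]
  [FiberBundle F V]

/-- The choices that enter the definition of a Sobolev norm on the sections of `V`: finitely many
charts of `M` over which `V` is trivialized, and a subordinate partition of unity. Two choices give
equivalent norms. -/
structure SobolevAtlas where
  /-- the number of charts -/
  card : ℕ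
  /-- the centres of the charts and of the trivializations -/
  center : Fin card → M
  /-- the partition of unity -/
  ρ : SmoothPartitionOfUnity (Fin card) I M univ
  subordinate : ρ.IsSubordinate fun i =>
    (chartAt H (center i)).source ∩ (trivializationAt F V (center i)).baseSet

theorem SobolevAtlas.nonempty [T2Space M] [CompactSpace M] [IsManifold I ∞ M] :
    Nonempty (SobolevAtlas I F V) := by
  obtain ⟨t, ht⟩ := isCompact_univ.elim_finite_subcover
    (fun c : M => (chartAt H c).source ∩ (trivializationAt F V c).baseSet)
    (fun c => (chartAt H c).open_source.inter (trivializationAt F V c).open_baseSet)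
    (fun x _ => mem_iUnion.2 ⟨x, mem_chart_source H x, mem_baseSet_trivializationAt F V x⟩)
  let c : Fin t.card → M := fun i => (t.equivFin.symm i : M)
  obtain ⟨ρ, hρ⟩ := SmoothPartitionOfUnity.exists_isSubordinate I (isClosed_univ (X := M))
    (fun i => (chartAt H (c i)).source ∩ (trivializationAt F V (c i)).baseSet)
    (fun i => (chartAt H (c i)).open_source.inter (trivializationAt F V (c i)).open_baseSet)
    (fun x hx => by
      obtain ⟨p, hp, hxp⟩ := mem_iUnion₂.1 (ht hx)
      exact mem_iUnion.2 ⟨t.equivFin ⟨p, hp⟩, by simpa [c] using hxp⟩)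
  exact ⟨⟨_, c, ρ, hρ⟩⟩

variable {I F V}

/-- The `i`-th piece `ρ_i s` of a section `s`, read in the `i`-th chart and trivialization, and
extended by `0`. -/
def localRep (𝔞 : SobolevAtlas I F V) (i : Fin 𝔞.card) (s : ∀ x, V x) : E → F :=
  (extChartAt I (𝔞.center i)).target.indicator fun y =>
    𝔞.ρ i ((extChartAt I (𝔞.center i)).symm y) •
      (trivializationAt F V (𝔞.center i)
        (TotalSpace.mk' F ((extChartAt I (𝔞.center i)).symm y)
          (s ((extChartAt I (𝔞.center i)).symm y)))).2

variable [∀ x, AddCommGroup (V x)] [∀ x, Module ℂ (V x)] [VectorBundle ℝ F V] [VectorBundle ℂ F V]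

theorem localRep_add (𝔞 : SobolevAtlas I F V) (i : Fin 𝔞.card) (s t : ∀ x, V x) :
    localRep 𝔞 i (s + t) = localRep 𝔞 i s + localRep 𝔞 i t := by
  funext y
  by_cases hy : y ∈ (extChartAt I (𝔞.center i)).target
  · simp only [localRep, Pi.add_apply, indicator_of_mem hy]
    by_cases h0 : 𝔞.ρ i ((extChartAt I (𝔞.center i)).symm y) = 0
    · simp only [h0, zero_smul, add_zero, smul_zero]
    · have hb := (𝔞.subordinate i (subset_tsupport _ h0)).2
      rw [← smul_add]
      congr 1
      exact ((trivializationAt F V (𝔞.center i)).linear ℂ hb).1 _ _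
  · simp only [localRep, Pi.add_apply, Pi.smul_apply, indicator_of_notMem hy, add_zero, smul_zero]

theorem localRep_smul (𝔞 : SobolevAtlas I F V) (i : Fin 𝔞.card) (c : ℂ) (s : ∀ x, V x) :
    localRep 𝔞 i (c • s) = c • localRep 𝔞 i s := by
  funext y
  by_cases hy : y ∈ (extChartAt I (𝔞.center i)).target
  · simp only [localRep, Pi.smul_apply, indicator_of_mem hy]
    by_cases h0 : 𝔞.ρ i ((extChartAt I (𝔞.center i)).symm y) = 0
    · simp only [h0, zero_smul, add_zero, smul_zero]
    · have hb := (𝔞.subordinate i (subset_tsupport _ h0)).2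
      rw [smul_comm c]
      congr 1
      exact ((trivializationAt F V (𝔞.center i)).linear ℂ hb).2 _ _
  · simp only [localRep, Pi.add_apply, Pi.smul_apply, indicator_of_notMem hy, add_zero, smul_zero]

/-- The compact subset of the `i`-th chart that carries all the pieces `localRep 𝔞 i s`. -/
def pieceSupport (𝔞 : SobolevAtlas I F V) (i : Fin 𝔞.card) : Set E :=
  extChartAt I (𝔞.center i) '' tsupport (𝔞.ρ i)

theorem isCompact_pieceSupport [CompactSpace M] (𝔞 : SobolevAtlas I F V) (i : Fin 𝔞.card) :
    IsCompact (pieceSupport 𝔞 i) := by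
  refine (isClosed_tsupport _).isCompact.image_of_continuousOn ?_
  refine (continuousOn_extChartAt (𝔞.center i)).mono fun x hx => ?_
  rw [extChartAt_source]
  exact (𝔞.subordinate i hx).1

theorem localRep_eq_zero (𝔞 : SobolevAtlas I F V) (i : Fin 𝔞.card) (s : ∀ x, V x) {y : E}
    (hy : y ∉ pieceSupport 𝔞 i) : localRep 𝔞 i s y = 0 := by
  by_cases ht : y ∈ (extChartAt I (𝔞.center i)).target
  · have h0 : 𝔞.ρ i ((extChartAt I (𝔞.center i)).symm y) = 0 := by
      by_contra h0
      exact hy ⟨_, subset_tsupport _ h0, (extChartAt I (𝔞.center i)).right_inv ht⟩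
    simp only [localRep, indicator_of_mem ht, h0, zero_smul]
  · simp only [localRep, indicator_of_notMem ht]

theorem hasCompactSupport_localRep [CompactSpace M] (𝔞 : SobolevAtlas I F V) (i : Fin 𝔞.card)
    (s : ∀ x, V x) : HasCompactSupport (localRep 𝔞 i s) :=
  HasCompactSupport.intro (isCompact_pieceSupport 𝔞 i) fun _ hy => localRep_eq_zero 𝔞 i s hy

variable [CompactSpace M] [IsManifold I ∞ M] [ContMDiffVectorBundle ∞ F V I]

theorem contDiffOn_localRep (𝔞 : SobolevAtlas I F V) (i : Fin 𝔞.card) (s : SmoothSections I F V) :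
    ContDiffOn ℝ ∞ (localRep 𝔞 i s.1) (range I) := by
  set φ := extChartAt I (𝔞.center i) with hφ
  set e := trivializationAt F V (𝔞.center i) with he
  have hg : ContMDiff I 𝓘(ℝ, F) ∞ fun x => 𝔞.ρ i x • (e (TotalSpace.mk' F x (s.1 x))).2 :=
    𝔞.ρ.contMDiff_smul (n := ⊤) fun x hx =>
      (e.contMDiffAt_section_iff (𝔞.subordinate i hx).2).1 (s.2 x)
  have h1 : ContDiffOn ℝ ∞ (localRep 𝔞 i s.1) φ.target := by
    have h2 := (hg.comp_contMDiffOn (contMDiffOn_extChartAt_symm (n := ∞) (𝔞.center i)))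
    refine (contMDiffOn_iff_contDiffOn.1 h2).congr fun y hy => ?_
    exact indicator_of_mem hy _
  intro y hy
  by_cases ht : y ∈ φ.target
  · exact (h1 y ht).mono_of_mem_nhdsWithin (extChartAt_target_mem_nhdsWithin_of_mem ht)
  · have hK : y ∉ pieceSupport 𝔞 i := by
      rintro ⟨x, hx, rfl⟩
      refine ht (φ.map_source ?_)
      rw [hφ, extChartAt_source]
      exact (𝔞.subordinate i hx).1
    have hev : localRep 𝔞 i s.1 =ᶠ[𝓝 y] fun _ => 0 := by
      filter_upwards [(isCompact_pieceSupport 𝔞 i).isClosed.isOpen_compl.mem_nhds hK] with z hz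
      exact localRep_eq_zero 𝔞 i s.1 hz
    exact (contDiffAt_const.congr_of_eventuallyEq hev).contDiffWithinAt

/-- The `k`-th derivative of the `i`-th piece of a smooth section. The model space is
`range I`, a half-space if `M` has a boundary. -/
def pieceDeriv (𝔞 : SobolevAtlas I F V) (i : Fin 𝔞.card) (k : ℕ) (s : SmoothSections I F V) :
    E → E [×k]→L[ℝ] F :=
  iteratedFDerivWithin ℝ k (localRep 𝔞 i s.1) (range I)

theorem memLp_pieceDeriv (𝔞 : SobolevAtlas I F V) (i : Fin 𝔞.card) (k : ℕ)
    (s : SmoothSections I F V) :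
    MemLp (pieceDeriv 𝔞 i k s) 2 (volume.restrict (range I)) := by
  have hK := isCompact_pieceSupport 𝔞 i
  have hc : ContinuousOn (pieceDeriv 𝔞 i k s) (range I) :=
    (contDiffOn_localRep 𝔞 i s).continuousOn_iteratedFDerivWithin
      (mod_cast le_top) I.uniqueDiffOn
  have h0 : ∀ y ∈ range I, y ∉ pieceSupport 𝔞 i → pieceDeriv 𝔞 i k s y = 0 := by
    intro y hy hyK
    have hev : localRep 𝔞 i s.1 =ᶠ[𝓝[range I] y] fun _ => 0 := by
      filter_upwards [mem_nhdsWithin_of_mem_nhds (hK.isClosed.isOpen_compl.mem_nhds hyK)] with z hz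
      exact localRep_eq_zero 𝔞 i s.1 hz
    have := hev.iteratedFDerivWithin_eq (𝕜 := ℝ) (localRep_eq_zero 𝔞 i s.1 hyK) k
    simpa [pieceDeriv] using this
  obtain ⟨C, hC⟩ := (hK.inter_right I.isClosed_range).exists_bound_of_continuousOn
    (hc.mono inter_subset_right)
  have hm : AEStronglyMeasurable (pieceDeriv 𝔞 i k s) (volume.restrict (range I)) :=
    hc.aestronglyMeasurable I.isClosed_range.measurableSet
  have hind : MemLp ((pieceSupport 𝔞 i).indicator (pieceDeriv 𝔞 i k s)) 2
      (volume.restrict (range I)) := by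
    refine (memLp_indicator_iff_restrict (f := pieceDeriv 𝔞 i k s) hK.isClosed.measurableSet).2 ?_
    have : IsFiniteMeasure ((volume.restrict (range I)).restrict (pieceSupport 𝔞 i)) :=
      ⟨by
        rw [Measure.restrict_apply_univ]
        exact (Measure.restrict_apply_le _ _).trans_lt hK.measure_lt_top⟩
    refine MemLp.of_bound (hm.mono_measure Measure.restrict_le_self) C ?_
    rw [Measure.restrict_restrict hK.isClosed.measurableSet]
    filter_upwards [ae_restrict_mem (hK.isClosed.measurableSet.inter
      I.isClosed_range.measurableSet)] with y hy
    exact hC y hy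
  refine hind.ae_eq ?_
  filter_upwards [ae_restrict_mem I.isClosed_range.measurableSet] with y hy
  by_cases hyK : y ∈ pieceSupport 𝔞 i
  · simp [hyK]
  · simp [hyK, h0 y hy hyK]

/-- The derivatives up to order `m` of all the pieces of a smooth section, as `L²` functions. -/
def sobolevJet (𝔞 : SobolevAtlas I F V) (m : ℕ) : SmoothSections I F V →ₗ[ℂ]
    ∀ p : Fin 𝔞.card × Fin (m + 1),
      Lp (E [×(p.2 : ℕ)]→L[ℝ] F) 2 (volume.restrict (range I)) where
  toFun s p := (memLp_pieceDeriv 𝔞 p.1 p.2 s).toLp _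
  map_add' s t := by
    funext p
    rw [Pi.add_apply, ← MemLp.toLp_add]
    refine MemLp.toLp_congr _ _ ?_
    filter_upwards [ae_restrict_mem I.isClosed_range.measurableSet] with y hy
    have := iteratedFDerivWithin_add_apply (i := (p.2 : ℕ)) (x := y)
      (((contDiffOn_localRep 𝔞 p.1 s) y hy).of_le (mod_cast le_top))
      (((contDiffOn_localRep 𝔞 p.1 t) y hy).of_le (mod_cast le_top)) I.uniqueDiffOn hy
    simpa [pieceDeriv, localRep_add] using this
  map_smul' c s := by
    funext p
    rw [Pi.smul_apply, RingHom.id_apply, ← MemLp.toLp_const_smul]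
    refine MemLp.toLp_congr _ _ ?_
    filter_upwards [ae_restrict_mem I.isClosed_range.measurableSet] with y hy
    have := iteratedFDerivWithin_const_smul_apply (i := (p.2 : ℕ)) (x := y) (a := c)
      (((contDiffOn_localRep 𝔞 p.1 s) y hy).of_le (mod_cast le_top)) I.uniqueDiffOn hy
    simpa [pieceDeriv, localRep_smul] using this

/-- The Sobolev space `H^m(V)`, `m ∈ ℕ`: the completion of `C^∞(V)` in the norm
`max_{i, k ≤ m} ‖D^k (ρ_i s)‖_{L²}`, realized as the closure of the space of jets of smooth
sections. For `m = 0` it is `L²(V)`. -/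
def SobolevSpace (𝔞 : SobolevAtlas I F V) (m : ℕ) : Type _ :=
  (LinearMap.range (sobolevJet 𝔞 m)).topologicalClosure

instance (𝔞 : SobolevAtlas I F V) (m : ℕ) : NormedAddCommGroup (SobolevSpace 𝔞 m) :=
  inferInstanceAs (NormedAddCommGroup (LinearMap.range (sobolevJet 𝔞 m)).topologicalClosure)

instance (𝔞 : SobolevAtlas I F V) (m : ℕ) : NormedSpace ℂ (SobolevSpace 𝔞 m) :=
  inferInstanceAs (NormedSpace ℂ (LinearMap.range (sobolevJet 𝔞 m)).topologicalClosure)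

instance [FiniteDimensional ℂ F] (𝔞 : SobolevAtlas I F V) (m : ℕ) : CompleteSpace (SobolevSpace 𝔞 m) := by
  have : CompleteSpace F := FiniteDimensional.complete ℂ F
  exact inferInstanceAs (CompleteSpace (LinearMap.range (sobolevJet 𝔞 m)).topologicalClosure)

/-- A smooth section as an element of `H^m(V)`. -/
def toSobolev (𝔞 : SobolevAtlas I F V) (m : ℕ) : SmoothSections I F V →ₗ[ℂ] SobolevSpace 𝔞 m :=
  (sobolevJet 𝔞 m).codRestrict _ fun s =>
    Submodule.le_topologicalClosure _ (LinearMap.mem_range_self _ s)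

variable [I.Boundaryless]

/-- On a manifold without boundary, the `i`-th piece of a smooth section as a Schwartz function. -/
def pieceSchwartz (𝔞 : SobolevAtlas I F V) (i : Fin 𝔞.card) :
    SmoothSections I F V →ₗ[ℂ] SchwartzMap E F where
  toFun s := (hasCompactSupport_localRep 𝔞 i s.1).toSchwartzMap
    (contDiffOn_univ.1 (I.range_eq_univ ▸ contDiffOn_localRep 𝔞 i s))
  map_add' s t := by ext y; exact congrFun (localRep_add 𝔞 i s.1 t.1) y
  map_smul' c s := by ext y; exact congrFun (localRep_smul 𝔞 i c s.1) y

/-- The Bessel potentials `𝓕⁻¹ (1 + |ξ|²)^{σ/2} 𝓕 (ρ_i s)` of all the pieces of a smooth section, as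
`L²` functions. -/
def besselJet (𝔞 : SobolevAtlas I F V) (σ : ℝ) : SmoothSections I F V →ₗ[ℂ]
    (Fin 𝔞.card → Lp F 2 (volume : Measure E)) :=
  LinearMap.pi fun i => (SchwartzMap.toLpCLM ℂ F 2 (volume : Measure E)).toLinearMap ∘ₗ
    (SchwartzMap.fourierMultiplierCLM F
      (fun ξ : E => (((1 + ‖ξ‖ ^ 2) ^ (σ / 2) : ℝ) : ℂ))).toLinearMap ∘ₗ pieceSchwartz 𝔞 i

/-- The Sobolev space `H^σ(V)`, `σ ∈ ℝ`, on a manifold without boundary: the completion of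
`C^∞(V)` in the norm `max_i ‖ρ_i s‖_{H^σ}`, with the Bessel potential norm of order `σ` on the
model space. -/
def FracSobolevSpace (𝔞 : SobolevAtlas I F V) (σ : ℝ) : Type _ :=
  (LinearMap.range (besselJet 𝔞 σ)).topologicalClosure

instance (𝔞 : SobolevAtlas I F V) (σ : ℝ) : NormedAddCommGroup (FracSobolevSpace 𝔞 σ) :=
  inferInstanceAs (NormedAddCommGroup (LinearMap.range (besselJet 𝔞 σ)).topologicalClosure)

instance (𝔞 : SobolevAtlas I F V) (σ : ℝ) : NormedSpace ℂ (FracSobolevSpace 𝔞 σ) :=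
  inferInstanceAs (NormedSpace ℂ (LinearMap.range (besselJet 𝔞 σ)).topologicalClosure)

instance [FiniteDimensional ℂ F] (𝔞 : SobolevAtlas I F V) (σ : ℝ) : CompleteSpace (FracSobolevSpace 𝔞 σ) := by
  have : CompleteSpace F := FiniteDimensional.complete ℂ F
  exact inferInstanceAs (CompleteSpace (LinearMap.range (besselJet 𝔞 σ)).topologicalClosure)

/-- A smooth section as an element of `H^σ(V)`. -/
def toFracSobolev (𝔞 : SobolevAtlas I F V) (σ : ℝ) :
    SmoothSections I F V →ₗ[ℂ] FracSobolevSpace 𝔞 σ :=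
  (besselJet 𝔞 σ).codRestrict _ fun s =>
    Submodule.le_topologicalClosure _ (LinearMap.mem_range_self _ s)

end Sobolev

/-! ### Boundary problems -/

section Problem

variable {E : Type*} [NormedAddCommGroup E] [InnerProductSpace ℝ E] [FiniteDimensional ℝ E]
  [MeasurableSpace E] [BorelSpace E]
  {H : Type*} [TopologicalSpace H] {I : ModelWithCorners ℝ E H}
  {M : Type*} [TopologicalSpace M] [ChartedSpace H M] [CompactSpace M] [IsManifold I ∞ M]
  {F : Type*} [NormedAddCommGroup F] [NormedSpace ℂ F] [FiniteDimensional ℂ F]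
  {V : M → Type*} [TopologicalSpace (TotalSpace F V)] [∀ x, TopologicalSpace (V x)]
  [∀ x, AddCommGroup (V x)] [∀ x, Module ℂ (V x)]
  [FiberBundle F V] [VectorBundle ℝ F V] [VectorBundle ℂ F V] [ContMDiffVectorBundle ∞ F V I]
  {E' : Type*} [NormedAddCommGroup E'] [InnerProductSpace ℝ E'] [FiniteDimensional ℝ E']
  [MeasurableSpace E'] [BorelSpace E']
  {H' : Type*} [TopologicalSpace H'] {J : ModelWithCorners ℝ E' H'} [J.Boundaryless]
  {N : Type*} [TopologicalSpace N] [ChartedSpace H' N] [CompactSpace N] [IsManifold J ∞ N]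
  {k : ℕ} {G : Fin k → Type*} [∀ j, NormedAddCommGroup (G j)] [∀ j, NormedSpace ℂ (G j)]
  [∀ j, FiniteDimensional ℂ (G j)]
  {W : ∀ _ : Fin k, N → Type*} [∀ j, TopologicalSpace (TotalSpace (G j) (W j))]
  [∀ j x, TopologicalSpace (W j x)] [∀ j x, AddCommGroup (W j x)] [∀ j x, Module ℂ (W j x)]
  [∀ j, FiberBundle (G j) (W j)] [∀ j, VectorBundle ℝ (G j) (W j)]
  [∀ j, VectorBundle ℂ (G j) (W j)] [∀ j, ContMDiffVectorBundle ∞ (G j) (W j) J]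

/-- The extension by continuity `H^r(V) → L²(V)` of an operator on `C^∞(V)`. Differential operators
of order at most `r` are bounded for these norms; `extendOfNorm` is `0` on unbounded operators. -/
def interiorExt (𝔞 : SobolevAtlas I F V) (r : ℕ)
    (A : SmoothSections I F V →ₗ[ℂ] SmoothSections I F V) :
    SobolevSpace 𝔞 r →L[ℂ] SobolevSpace 𝔞 0 :=
  (toSobolev 𝔞 0 ∘ₗ A).extendOfNorm (toSobolev 𝔞 r)

/-- The inclusion `H^r(V) → L²(V)`. -/
def inclL2 (𝔞 : SobolevAtlas I F V) (r : ℕ) : SobolevSpace 𝔞 r →L[ℂ] SobolevSpace 𝔞 0 :=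
  interiorExt 𝔞 r LinearMap.id

/-- The space `⨁_j H^{r - m_j - 1/2}(W_j)` of boundary data. -/
abbrev BoundaryData (𝔟 : ∀ j, SobolevAtlas J (G j) (W j)) (r : ℕ) (m : Fin k → ℕ) : Type _ :=
  ∀ j, FracSobolevSpace (𝔟 j) ((r : ℝ) - m j - 1 / 2)

/-- The extension by continuity `H^r(V) → ⨁_j H^{r - m_j - 1/2}(W_j)` of a tuple of operators
`B_j : C^∞(V) → C^∞(W_j)`. -/
def boundaryExt (𝔞 : SobolevAtlas I F V) (𝔟 : ∀ j, SobolevAtlas J (G j) (W j)) (r : ℕ)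
    (m : Fin k → ℕ) (B : ∀ j, SmoothSections I F V →ₗ[ℂ] SmoothSections J (G j) (W j)) :
    SobolevSpace 𝔞 r →L[ℂ] BoundaryData 𝔟 r m :=
  ContinuousLinearMap.pi fun j =>
    (toFracSobolev (𝔟 j) ((r : ℝ) - m j - 1 / 2) ∘ₗ B j).extendOfNorm (toSobolev 𝔞 r)

/-- The orders `m_j = ord B_j` of a tuple of boundary operators. -/
def orders (ι : C^∞⟮J, N; I, M⟯)
    (B : ∀ j, SmoothSections I F V →ₗ[ℂ] SmoothSections J (G j) (W j)) : Fin k → ℕ :=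
  fun j => diffOrder ι (B j)

/-- The operator
`(A - z, B) : H^r(V) → L²(V) ⊕ ⨁_j H^{r - ord B_j - 1/2}(W_j)` of a boundary problem. -/
def problem (𝔞 : SobolevAtlas I F V) (𝔟 : ∀ j, SobolevAtlas J (G j) (W j))
    (ι : C^∞⟮J, N; I, M⟯) (r : ℕ) (A : SmoothSections I F V →ₗ[ℂ] SmoothSections I F V)
    (B : ∀ j, SmoothSections I F V →ₗ[ℂ] SmoothSections J (G j) (W j)) (z : ℂ) :
    SobolevSpace 𝔞 r →L[ℂ] SobolevSpace 𝔞 0 × BoundaryData 𝔟 r (orders ι B) :=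
  (interiorExt 𝔞 r A - z • inclL2 𝔞 r).prod (boundaryExt 𝔞 𝔟 r (orders ι B) B)

/-- The resolvent operator `R(z) : L²(V) → H^r(V)`, `u ↦ (A - z, B)⁻¹ (u, 0)`. -/
def resolventOp (𝔞 : SobolevAtlas I F V) (𝔟 : ∀ j, SobolevAtlas J (G j) (W j))
    (ι : C^∞⟮J, N; I, M⟯) (r : ℕ) (A : SmoothSections I F V →ₗ[ℂ] SmoothSections I F V)
    (B : ∀ j, SmoothSections I F V →ₗ[ℂ] SmoothSections J (G j) (W j)) (z : ℂ) :
    SobolevSpace 𝔞 0 →L[ℂ] SobolevSpace 𝔞 r :=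
  (problem 𝔞 𝔟 ι r A B z).inverse ∘L
    ContinuousLinearMap.inl ℂ (SobolevSpace 𝔞 0) (BoundaryData 𝔟 r (orders ι B))

/-- The Poisson operator `P(z) : ⨁_j H^{r - ord B_j - 1/2}(W_j) → H^r(V)`,
`f ↦ (A - z, B)⁻¹ (0, f)`. -/
def poissonOp (𝔞 : SobolevAtlas I F V) (𝔟 : ∀ j, SobolevAtlas J (G j) (W j))
    (ι : C^∞⟮J, N; I, M⟯) (r : ℕ) (A : SmoothSections I F V →ₗ[ℂ] SmoothSections I F V)
    (B : ∀ j, SmoothSections I F V →ₗ[ℂ] SmoothSections J (G j) (W j)) (z : ℂ) :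
    BoundaryData 𝔟 r (orders ι B) →L[ℂ] SobolevSpace 𝔞 r :=
  (problem 𝔞 𝔟 ι r A B z).inverse ∘L
    ContinuousLinearMap.inr ℂ (SobolevSpace 𝔞 0) (BoundaryData 𝔟 r (orders ι B))

/-- The spectrum of the realization `A_B` of `A` with domain `ker B ⊆ H^r(V)`: the set of all `z`
for which `A_B - z : ker B → L²(V)` is not bijective. (A bounded bijection between the Banach spaces
`ker B` and `L²(V)` has a bounded inverse.) -/
def realizationSpectrum (𝔞 : SobolevAtlas I F V) (𝔟 : ∀ j, SobolevAtlas J (G j) (W j))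
    (ι : C^∞⟮J, N; I, M⟯) (r : ℕ) (A : SmoothSections I F V →ₗ[ℂ] SmoothSections I F V)
    (B : ∀ j, SmoothSections I F V →ₗ[ℂ] SmoothSections J (G j) (W j)) : Set ℂ :=
  {z | ¬ Function.Bijective
    fun u : LinearMap.ker (boundaryExt 𝔞 𝔟 r (orders ι B) B).toLinearMap =>
      interiorExt 𝔞 r A u - z • inclL2 𝔞 r u}

/-- The interpolating boundary operators `B_t = (1 - t) B_0 + t B_1`. -/
def interp (B₀ B₁ : ∀ j, SmoothSections I F V →ₗ[ℂ] SmoothSections J (G j) (W j)) (t : ℝ) :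
    ∀ j, SmoothSections I F V →ₗ[ℂ] SmoothSections J (G j) (W j) :=
  fun j => ((1 - t : ℝ) : ℂ) • B₀ j + (t : ℂ) • B₁ j

end Problem

end BVP

/-! ### Functional analysis -/

section FunctionalAnalysis

/-! Both formulas are instances of `(T⁻¹)' = -T⁻¹ T' T⁻¹` (`HasDerivAt.clm_inverse`) for `T = (A -
z, B_t)`. The path is affine in `t` with slope `(0, B')`, and affine in `z` with slope `(-1, 0)`.
Restricting `T⁻¹` to the first or second summand gives `R` or `P`, so the formulas can be read off.

Two points need care. The target of `T` depends on `ord B_t`; since `ord B₀ < ord B₁`, this order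
equals `ord B₁` for all `t ≠ 0` (`diffOrder_smul_add_smul`), so near `t > 0` the path lies in one
operator space. Moreover `B'` must be continuous into that space, since `extendOfNorm` is `0` on
unbounded operators. No trace theorem is used: surjectivity of `(A, B_s)` forces each `B_s` to be
continuous (`LinearMap.BoundedAlong.of_surjective`), and `B'` is a difference quotient of two of
them. -/

theorem HasDerivAt.ringInverse_of_eq_one {𝕜 R : Type*} [NontriviallyNormedField 𝕜] [NormedRing R]
    [HasSummableGeomSeries R] [NormedAlgebra 𝕜 R] {c : 𝕜 → R} {c' : R} {x : 𝕜}
    (hc : HasDerivAt c c' x) (hx : c x = 1) :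
    HasDerivAt (fun y => Ring.inverse (c y)) (-c') x := by
  have h := hasFDerivAt_ringInverse (𝕜 := 𝕜) (1 : Rˣ)
  rw [Units.val_one, ← hx] at h
  refine (h.comp_hasDerivAt x hc).congr_deriv ?_
  rw [neg_apply, ContinuousLinearMap.mulLeftRight_apply, inv_one, Units.val_one,
    one_mul, mul_one]

/-- Composition with the fixed inverse of `T x` turns the path into one through `1` in the Banach
algebra of operators on `X`, where inversion is differentiable. -/
theorem HasDerivAt.clm_inverse {𝕜 X Y : Type*} [NontriviallyNormedField 𝕜]
    [NormedAddCommGroup X] [NormedSpace 𝕜 X] [CompleteSpace X]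
    [NormedAddCommGroup Y] [NormedSpace 𝕜 Y]
    {T : 𝕜 → X →L[𝕜] Y} {T' : X →L[𝕜] Y} {x : 𝕜}
    (hT : HasDerivAt T T' x) (hx : (T x).IsInvertible) :
    HasDerivAt (fun y => (T y).inverse) (-((T x).inverse ∘L T' ∘L (T x).inverse)) x := by
  obtain ⟨e, he⟩ := hx
  have h₁ : HasDerivAt (fun y => (e.symm : Y →L[𝕜] X) ∘L T y) ((e.symm : Y →L[𝕜] X) ∘L T') x := by
    simpa using (hasDerivAt_const x (e.symm : Y →L[𝕜] X)).clm_comp hT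
  have hone : (e.symm : Y →L[𝕜] X) ∘L T x = 1 := by
    rw [← he]; ext v; simp
  have h₃ := (h₁.ringInverse_of_eq_one hone).clm_comp (hasDerivAt_const x (e.symm : Y →L[𝕜] X))
  -- The identity holds for every `y`: if `T y` is not invertible, both sides are `0`.
  refine (h₃.congr_of_eventuallyEq (Filter.Eventually.of_forall fun y =>
    ContinuousLinearMap.inverse_eq_ringInverse e (T y))).congr_deriv ?_
  rw [← he]
  ext v
  simp

/-- This is the open mapping theorem. -/
theorem ContinuousLinearMap.isInvertible_of_bijective {𝕜 X Y : Type*} [NontriviallyNormedField 𝕜]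
    [NormedAddCommGroup X] [NormedSpace 𝕜 X] [CompleteSpace X]
    [NormedAddCommGroup Y] [NormedSpace 𝕜 Y] [CompleteSpace Y]
    {T : X →L[𝕜] Y} (hT : Function.Bijective T) : T.IsInvertible :=
  ⟨ContinuousLinearEquiv.ofBijective T (LinearMap.ker_eq_bot.2 hT.1)
    (LinearMap.range_eq_top.2 hT.2), by ext; rfl⟩

/-- If `B` is onto and `A` restricts to a bijection on `ker B`, then `(A, B)` is bijective. -/
theorem LinearMap.bijective_prod_of_bijective_ker {R X Y Z : Type*} [Ring R]
    [AddCommGroup X] [Module R X] [AddCommGroup Y] [Module R Y] [AddCommGroup Z] [Module R Z]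
    (A : X →ₗ[R] Y) (B : X →ₗ[R] Z) (hB : Function.Surjective B)
    (hA : Function.Bijective fun u : LinearMap.ker B => A u) :
    Function.Bijective (A.prod B) := by
  constructor
  · rw [← LinearMap.ker_eq_bot, LinearMap.ker_eq_bot']
    intro u hu
    have hu₁ : A u = 0 := congrArg Prod.fst hu
    have hu₂ : B u = 0 := congrArg Prod.snd hu
    have := hA.1 (a₁ := ⟨u, hu₂⟩) (a₂ := 0) (by simpa using hu₁)
    simpa using congrArg Subtype.val this
  · rintro ⟨y, w⟩
    obtain ⟨v, rfl⟩ := hB w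
    -- The defect left by the lift `v` is corrected inside `ker B`, which leaves the second
    -- component alone.
    obtain ⟨u, hu⟩ := hA.2 (y - A v)
    refine ⟨u + v, Prod.ext ?_ ?_⟩
    · simpa using congrArg (· + A v) hu
    · simp

/-- Applied to jets, this makes smooth sections dense in the Sobolev space, so that extensions by
continuity are unique. -/
theorem LinearMap.denseRange_codRestrict_topologicalClosure {R X Y : Type*} [Semiring R]
    [AddCommMonoid X] [Module R X] [AddCommMonoid Y] [Module R Y] [TopologicalSpace Y]
    [ContinuousAdd Y] [ContinuousConstSMul R Y] (f : X →ₗ[R] Y) :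
    DenseRange (f.codRestrict (LinearMap.range f).topologicalClosure fun x =>
      Submodule.le_topologicalClosure _ (LinearMap.mem_range_self _ x)) := by
  intro y
  rw [Topology.IsInducing.subtypeVal.closure_eq_preimage_closure_image, Set.mem_preimage,
    ← Set.range_comp]
  exact y.2

/-! ### Bounded operators and their extension by continuity -/

section ExtendOfNorm

variable {𝕜 S X Y : Type*} [NontriviallyNormedField 𝕜] [AddCommGroup S] [Module 𝕜 S]
  [NormedAddCommGroup X] [NormedSpace 𝕜 X] [NormedAddCommGroup Y] [NormedSpace 𝕜 Y]

/-- `f` is bounded with respect to the norm induced by `e`. -/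
def LinearMap.BoundedAlong (e : S →ₗ[𝕜] X) (f : S →ₗ[𝕜] Y) : Prop :=
  ∃ C : ℝ, ∀ x, ‖f x‖ ≤ C * ‖e x‖

namespace LinearMap.BoundedAlong

theorem add {e : S →ₗ[𝕜] X} {f g : S →ₗ[𝕜] Y} (hf : BoundedAlong e f) (hg : BoundedAlong e g) :
    BoundedAlong e (f + g) := by
  obtain ⟨C, hC⟩ := hf
  obtain ⟨D, hD⟩ := hg
  refine ⟨C + D, fun x => ?_⟩
  rw [add_mul]
  exact (norm_add_le _ _).trans (add_le_add (hC x) (hD x))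

theorem smul {e : S →ₗ[𝕜] X} {f : S →ₗ[𝕜] Y} (c : 𝕜) (hf : BoundedAlong e f) :
    BoundedAlong e (c • f) := by
  obtain ⟨C, hC⟩ := hf
  refine ⟨‖c‖ * C, fun x => ?_⟩
  rw [LinearMap.smul_apply, norm_smul, mul_assoc]
  exact mul_le_mul_of_nonneg_left (hC x) (norm_nonneg c)

/-- An operator whose extension by continuity is onto is bounded: for an unbounded operator
`extendOfNorm` is `0`, which is onto only if `Y = 0`, and then every operator is bounded. -/
theorem of_surjective [CompleteSpace Y] {e : S →ₗ[𝕜] X} {f : S →ₗ[𝕜] Y}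
    (hf : Function.Surjective (f.extendOfNorm e)) : BoundedAlong e f := by
  by_contra h
  have h₀ : f.compLeftInverse e = 0 := by
    unfold LinearMap.compLeftInverse
    exact dif_neg h
  have h₁ : f.extendOfNorm e = 0 := by
    unfold LinearMap.extendOfNorm
    rw [h₀]
    -- Either the zero map is genuinely extended, or `extend` takes its default value `0`; density
    -- of `e` is therefore not needed.
    by_cases hd : DenseRange (LinearMap.range e).subtypeL ∧
        IsUniformInducing (LinearMap.range e).subtypeL
    · exact ContinuousLinearMap.extend_zero hd.1 hd.2
    · unfold ContinuousLinearMap.extend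
      exact dif_neg hd
  refine h ⟨0, fun x => ?_⟩
  obtain ⟨u, hu⟩ := hf (f x)
  rw [← hu, h₁]
  simp

/-- Both bounds are essential: with the default value `0`, unbounded summands with a bounded sum
would break additivity. -/
theorem extendOfNorm_add_smul [CompleteSpace Y] {e : S →ₗ[𝕜] X} {f g : S →ₗ[𝕜] Y}
    (he : DenseRange e) (c : 𝕜)
    (hf : BoundedAlong e f) (hg : BoundedAlong e g) :
    (f + c • g).extendOfNorm e = f.extendOfNorm e + c • g.extendOfNorm e := by
  obtain ⟨C, hC⟩ := hf.add (hg.smul c)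
  refine LinearMap.extendOfNorm_unique he C hC _ ?_
  ext x
  have h₁ := LinearMap.extendOfNorm_eq he hf x
  have h₂ := LinearMap.extendOfNorm_eq he hg x
  simp [h₁, h₂]

end LinearMap.BoundedAlong

end ExtendOfNorm

end FunctionalAnalysis

namespace BVP

/-! ### The order of a differential operator -/

section DiffOp

variable {E : Type*} [NormedAddCommGroup E] [NormedSpace ℝ E]
  {H : Type*} [TopologicalSpace H] {I : ModelWithCorners ℝ E H}
  {M : Type*} [TopologicalSpace M] [ChartedSpace H M]
  {F : Type*} [NormedAddCommGroup F] [NormedSpace ℂ F]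
  {V : M → Type*} [TopologicalSpace (TotalSpace F V)] [∀ x, TopologicalSpace (V x)]
  [∀ x, AddCommGroup (V x)] [∀ x, Module ℂ (V x)]
  [FiberBundle F V] [VectorBundle ℝ F V] [VectorBundle ℂ F V]
  {E' : Type*} [NormedAddCommGroup E'] [NormedSpace ℝ E']
  {H' : Type*} [TopologicalSpace H'] {J : ModelWithCorners ℝ E' H'}
  {N : Type*} [TopologicalSpace N] [ChartedSpace H' N]
  {G : Type*} [NormedAddCommGroup G] [NormedSpace ℂ G]
  {W : N → Type*} [TopologicalSpace (TotalSpace G W)] [∀ x, TopologicalSpace (W x)]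
  [∀ x, AddCommGroup (W x)] [∀ x, Module ℂ (W x)]
  [FiberBundle G W] [VectorBundle ℝ G W] [VectorBundle ℂ G W]
  {ι : C^∞⟮J, N; I, M⟯}

theorem commutator_add (f : C^∞⟮I, M; 𝓘(ℝ, ℝ), ℝ⟯)
    (B C : SmoothSections I F V →ₗ[ℂ] SmoothSections J G W) :
    commutator ι f (B + C) = commutator ι f B + commutator ι f C := by
  unfold commutator
  rw [LinearMap.add_comp, LinearMap.comp_add]
  abel

theorem commutator_smul (f : C^∞⟮I, M; 𝓘(ℝ, ℝ), ℝ⟯) (c : ℂ)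
    (B : SmoothSections I F V →ₗ[ℂ] SmoothSections J G W) :
    commutator ι f (c • B) = c • commutator ι f B := by
  unfold commutator
  rw [LinearMap.smul_comp, LinearMap.comp_smul]
  module

theorem IsDiffOp.add {m : ℕ} {B C : SmoothSections I F V →ₗ[ℂ] SmoothSections J G W}
    (hB : IsDiffOp ι m B) (hC : IsDiffOp ι m C) : IsDiffOp ι m (B + C) := by
  induction m generalizing B C with
  | zero => intro f; rw [commutator_add, hB f, hC f, add_zero]
  | succ m ih => intro f; rw [commutator_add]; exact ih (hB f) (hC f)

theorem IsDiffOp.smul {m : ℕ} {B : SmoothSections I F V →ₗ[ℂ] SmoothSections J G W}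
    (c : ℂ) (hB : IsDiffOp ι m B) : IsDiffOp ι m (c • B) := by
  induction m generalizing B with
  | zero => intro f; rw [commutator_smul, hB f, smul_zero]
  | succ m ih => intro f; rw [commutator_smul]; exact ih (hB f)

theorem IsDiffOp.succ {m : ℕ} {B : SmoothSections I F V →ₗ[ℂ] SmoothSections J G W}
    (hB : IsDiffOp ι m B) : IsDiffOp ι (m + 1) B := by
  induction m generalizing B with
  | zero =>
    intro f g
    rw [hB f]
    simpa using commutator_smul (ι := ι) g 0 (0 : SmoothSections I F V →ₗ[ℂ] SmoothSections J G W)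
  | succ m ih => intro f; exact ih (hB f)

theorem IsDiffOp.mono {m m' : ℕ} (h : m ≤ m')
    {B : SmoothSections I F V →ₗ[ℂ] SmoothSections J G W}
    (hB : IsDiffOp ι m B) : IsDiffOp ι m' B := by
  induction h with
  | refl => exact hB
  | step _ ih => exact ih.succ

/-- The existence hypothesis excludes the default `sInf ∅ = 0`. -/
theorem isDiffOp_diffOrder {B : SmoothSections I F V →ₗ[ℂ] SmoothSections J G W}
    (hB : ∃ m, IsDiffOp ι m B) : IsDiffOp ι (diffOrder ι B) B :=
  Nat.sInf_mem (s := {m | IsDiffOp ι m B}) hB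

theorem diffOrder_le {m : ℕ} {B : SmoothSections I F V →ₗ[ℂ] SmoothSections J G W}
    (hB : IsDiffOp ι m B) : diffOrder ι B ≤ m :=
  Nat.sInf_le (s := {m | IsDiffOp ι m B}) hB

/-- An operator of lower order does not change the order of a nonzero multiple. -/
theorem diffOrder_smul_add_smul {B C : SmoothSections I F V →ₗ[ℂ] SmoothSections J G W}
    (hB : ∃ m, IsDiffOp ι m B) (hC : ∃ m, IsDiffOp ι m C)
    (h : diffOrder ι B < diffOrder ι C) (b : ℂ) {c : ℂ} (hc : c ≠ 0) :
    diffOrder ι (b • B + c • C) = diffOrder ι C := by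
  have hB' := isDiffOp_diffOrder hB
  have hD : IsDiffOp ι (diffOrder ι C) (b • B + c • C) :=
    ((hB'.mono h.le).smul b).add ((isDiffOp_diffOrder hC).smul c)
  refine le_antisymm (diffOrder_le hD) ?_
  by_contra! hlt
  -- If the sum had smaller order than `C`, solving for `C` would give it order at most `m <
  -- diffOrder ι C`.
  set m := max (diffOrder ι (b • B + c • C)) (diffOrder ι B) with hm
  have h₁ : IsDiffOp ι m (c⁻¹ • ((b • B + c • C) + (-b) • B)) :=
    (((isDiffOp_diffOrder ⟨_, hD⟩).mono (le_max_left _ _)).add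
      ((hB'.mono (le_max_right _ _)).smul _)).smul _
  have h₂ : c⁻¹ • ((b • B + c • C) + (-b) • B) = C := by
    have h₃ : c⁻¹ • ((b • B + c • C) + (-b) • B) = (c⁻¹ * c) • C := by module
    rw [h₃, inv_mul_cancel₀ hc, one_smul]
  rw [h₂] at h₁
  exact absurd (diffOrder_le h₁) (not_le.2 (max_lt hlt h))

end DiffOp

/-! ### Boundary problems -/

section Problem

variable {E : Type*} [NormedAddCommGroup E] [InnerProductSpace ℝ E] [FiniteDimensional ℝ E]
  [MeasurableSpace E] [BorelSpace E]
  {H : Type*} [TopologicalSpace H] {I : ModelWithCorners ℝ E H}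
  {M : Type*} [TopologicalSpace M] [ChartedSpace H M] [CompactSpace M] [IsManifold I ∞ M]
  {F : Type*} [NormedAddCommGroup F] [NormedSpace ℂ F] [FiniteDimensional ℂ F]
  {V : M → Type*} [TopologicalSpace (TotalSpace F V)] [∀ x, TopologicalSpace (V x)]
  [∀ x, AddCommGroup (V x)] [∀ x, Module ℂ (V x)]
  [FiberBundle F V] [VectorBundle ℝ F V] [VectorBundle ℂ F V] [ContMDiffVectorBundle ∞ F V I]
  {E' : Type*} [NormedAddCommGroup E'] [InnerProductSpace ℝ E'] [FiniteDimensional ℝ E']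
  [MeasurableSpace E'] [BorelSpace E']
  {H' : Type*} [TopologicalSpace H'] {J : ModelWithCorners ℝ E' H'} [J.Boundaryless]
  {N : Type*} [TopologicalSpace N] [ChartedSpace H' N] [CompactSpace N] [IsManifold J ∞ N]
  {k : ℕ} {G : Fin k → Type*} [∀ j, NormedAddCommGroup (G j)] [∀ j, NormedSpace ℂ (G j)]
  [∀ j, FiniteDimensional ℂ (G j)]
  {W : ∀ _ : Fin k, N → Type*} [∀ j, TopologicalSpace (TotalSpace (G j) (W j))]
  [∀ j x, TopologicalSpace (W j x)] [∀ j x, AddCommGroup (W j x)] [∀ j x, Module ℂ (W j x)]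
  [∀ j, FiberBundle (G j) (W j)] [∀ j, VectorBundle ℝ (G j) (W j)]
  [∀ j, VectorBundle ℂ (G j) (W j)] [∀ j, ContMDiffVectorBundle ∞ (G j) (W j) J]
  {𝔞 : SobolevAtlas I F V} {𝔟 : ∀ j, SobolevAtlas J (G j) (W j)} {ι : C^∞⟮J, N; I, M⟯} {r : ℕ}
  {A : SmoothSections I F V →ₗ[ℂ] SmoothSections I F V}
  {B B₀ B₁ : ∀ j, SmoothSections I F V →ₗ[ℂ] SmoothSections J (G j) (W j)}

/-! ### Bijectivity off the spectrum and the derivative in `z` -/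

theorem denseRange_toSobolev (𝔞 : SobolevAtlas I F V) (m : ℕ) : DenseRange (toSobolev 𝔞 m) :=
  (sobolevJet 𝔞 m).denseRange_codRestrict_topologicalClosure

/-- The boundary component does not involve `z`, so its surjectivity is inherited from the problem
at `0`. -/
theorem bijective_problem_of_notMem_realizationSpectrum
    (h₀ : Function.Bijective (problem 𝔞 𝔟 ι r A B 0)) {z : ℂ}
    (hz : z ∉ realizationSpectrum 𝔞 𝔟 ι r A B) :
    Function.Bijective (problem 𝔞 𝔟 ι r A B z) := by
  refine LinearMap.bijective_prod_of_bijective_ker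
    (interiorExt 𝔞 r A - z • inclL2 𝔞 r).toLinearMap
    (boundaryExt 𝔞 𝔟 r (orders ι B) B).toLinearMap (fun w => ?_) (not_not.1 hz)
  obtain ⟨u, hu⟩ := h₀.2 (0, w)
  exact ⟨u, congrArg Prod.snd hu⟩

/-- The slope in `z` is minus the inclusion into the first summand; this sign cancels the one from
differentiating the inverse. -/
theorem hasDerivAt_poissonOp {z : ℂ} (hz : Function.Bijective (problem 𝔞 𝔟 ι r A B z)) :
    HasDerivAt (fun ζ : ℂ => poissonOp 𝔞 𝔟 ι r A B ζ)
      (resolventOp 𝔞 𝔟 ι r A B z ∘L inclL2 𝔞 r ∘L poissonOp 𝔞 𝔟 ι r A B z) z := by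
  set S : SobolevSpace 𝔞 r →L[ℂ] SobolevSpace 𝔞 0 × BoundaryData 𝔟 r (orders ι B) :=
    ContinuousLinearMap.inl ℂ _ _ ∘L inclL2 𝔞 r with hS
  have hT : HasDerivAt (fun ζ : ℂ => problem 𝔞 𝔟 ι r A B ζ) (-S) z := by
    have h : (fun ζ : ℂ => problem 𝔞 𝔟 ι r A B ζ) =
        fun ζ : ℂ => problem 𝔞 𝔟 ι r A B 0 + ζ • -S := by
      funext ζ
      ext u <;> simp [problem, hS, sub_eq_add_neg]
    rw [h]
    simpa using ((hasDerivAt_id z).smul_const (-S)).const_add (problem 𝔞 𝔟 ι r A B 0)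
  have h := (hT.clm_inverse (ContinuousLinearMap.isInvertible_of_bijective hz)).clm_comp
    (hasDerivAt_const z
      (ContinuousLinearMap.inr ℂ (SobolevSpace 𝔞 0) (BoundaryData 𝔟 r (orders ι B))))
  refine h.congr_deriv ?_
  ext u
  simp [resolventOp, poissonOp, hS]

/-! ### Continuity of the boundary operators along the path -/

/-- The components of `B` are bounded from `H^r(V)` to `H^{r - m_j - 1/2}(W_j)`. -/
def IsBoundedBoundaryOp (𝔞 : SobolevAtlas I F V) (𝔟 : ∀ j, SobolevAtlas J (G j) (W j)) (r : ℕ)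
    (m : Fin k → ℕ) (B : ∀ j, SmoothSections I F V →ₗ[ℂ] SmoothSections J (G j) (W j)) : Prop :=
  ∀ j, LinearMap.BoundedAlong (toSobolev 𝔞 r)
    (toFracSobolev (𝔟 j) ((r : ℝ) - m j - 1 / 2) ∘ₗ B j)

/-- Invertibility of a boundary problem includes the continuity of its boundary operators. -/
theorem isBoundedBoundaryOp_of_bijective_problem {z : ℂ}
    (h : Function.Bijective (problem 𝔞 𝔟 ι r A B z)) :
    IsBoundedBoundaryOp 𝔞 𝔟 r (orders ι B) B := by
  intro j
  refine LinearMap.BoundedAlong.of_surjective fun w => ?_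
  -- Prescribing `w` in slot `j` and zero elsewhere isolates the surjectivity of the `j`-th
  -- component.
  obtain ⟨u, hu⟩ := h.2 (0, Pi.single j w)
  refine ⟨u, ?_⟩
  have hj : ((problem 𝔞 𝔟 ι r A B z u).2) j = (Pi.single j w : BoundaryData 𝔟 r (orders ι B)) j :=
    congrFun (congrArg Prod.snd hu) j
  rw [Pi.single_eq_same] at hj
  exact hj

theorem boundaryExt_add_smul {m : Fin k → ℕ}
    {C : ∀ j, SmoothSections I F V →ₗ[ℂ] SmoothSections J (G j) (W j)} (c : ℂ)
    (hB : IsBoundedBoundaryOp 𝔞 𝔟 r m B) (hC : IsBoundedBoundaryOp 𝔞 𝔟 r m C) :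
    boundaryExt 𝔞 𝔟 r m (B + c • C) =
      boundaryExt 𝔞 𝔟 r m B + c • boundaryExt 𝔞 𝔟 r m C := by
  ext u j
  have h := LinearMap.BoundedAlong.extendOfNorm_add_smul (denseRange_toSobolev 𝔞 r) c (hB j) (hC j)
  rw [← LinearMap.comp_smul, ← LinearMap.comp_add] at h
  exact congrArg (fun T => T u) h

theorem interp_eq_add_smul (B₀ B₁ : ∀ j, SmoothSections I F V →ₗ[ℂ] SmoothSections J (G j) (W j))
    (t τ : ℝ) : interp B₀ B₁ τ = interp B₀ B₁ t + ((τ : ℂ) - t) • (B₁ - B₀) := by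
  funext j
  simp only [interp, Pi.add_apply, Pi.smul_apply, Pi.sub_apply]
  push_cast
  module

/-- `B' = (B_s - B_t) / (s - t)`, so two continuous members of the path suffice. -/
theorem isBoundedBoundaryOp_sub {m : Fin k → ℕ} {s t : ℝ} (hst : s ≠ t)
    (hs : IsBoundedBoundaryOp 𝔞 𝔟 r m (interp B₀ B₁ s))
    (ht : IsBoundedBoundaryOp 𝔞 𝔟 r m (interp B₀ B₁ t)) :
    IsBoundedBoundaryOp 𝔞 𝔟 r m (B₁ - B₀) := by
  intro j
  have h := ((hs j).add ((ht j).smul (-1))).smul ((s : ℂ) - t)⁻¹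
  rw [← LinearMap.comp_smul, ← LinearMap.comp_add, ← LinearMap.comp_smul] at h
  have hne : (s : ℂ) - t ≠ 0 := sub_ne_zero.2 (mod_cast hst)
  convert h using 2
  rw [interp_eq_add_smul B₀ B₁ t s, Pi.add_apply, Pi.smul_apply]
  have h' : ((s : ℂ) - t)⁻¹ • (interp B₀ B₁ t j + ((s : ℂ) - t) • (B₁ - B₀) j +
      (-1 : ℂ) • interp B₀ B₁ t j) = (((s : ℂ) - t)⁻¹ * ((s : ℂ) - t)) • (B₁ - B₀) j := by
    module
  rw [h', inv_mul_cancel₀ hne, one_smul]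

/-- The coefficient of the higher-order operator `B₁` is `t`, so only `t = 0` is exceptional; `t`
may exceed `1`. -/
theorem orders_interp (hB₀ : ∀ j, ∃ m, IsDiffOp ι m (B₀ j)) (hB₁ : ∀ j, ∃ m, IsDiffOp ι m (B₁ j))
    (hord : ∀ j, diffOrder ι (B₀ j) < diffOrder ι (B₁ j)) {t : ℝ} (ht : t ≠ 0) :
    orders ι (interp B₀ B₁ t) = orders ι B₁ :=
  funext fun j => diffOrder_smul_add_smul (hB₀ j) (hB₁ j) (hord j) _ (mod_cast ht)

/-! ### The derivative in `t`, with frozen boundary orders -/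

/-- The operator `(A - z, B)` on boundary data of prescribed orders. -/
def problemOfOrders (𝔞 : SobolevAtlas I F V) (𝔟 : ∀ j, SobolevAtlas J (G j) (W j)) (r : ℕ)
    (m : Fin k → ℕ) (A : SmoothSections I F V →ₗ[ℂ] SmoothSections I F V)
    (B : ∀ j, SmoothSections I F V →ₗ[ℂ] SmoothSections J (G j) (W j)) (z : ℂ) :
    SobolevSpace 𝔞 r →L[ℂ] SobolevSpace 𝔞 0 × BoundaryData 𝔟 r m :=
  (interiorExt 𝔞 r A - z • inclL2 𝔞 r).prod (boundaryExt 𝔞 𝔟 r m B)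

/-- The boundary space, whose type depends on the orders, is internal to `R` and to the composite `P
B'` below, so both can be rewritten with fixed orders `m`. -/
theorem resolventOp_eq {m : Fin k → ℕ} (hm : orders ι B = m) (z : ℂ) :
    resolventOp 𝔞 𝔟 ι r A B z =
      (problemOfOrders 𝔞 𝔟 r m A B z).inverse ∘L ContinuousLinearMap.inl ℂ _ _ := by
  subst hm; rfl

theorem poissonOp_comp_boundaryExt_eq {m : Fin k → ℕ} (hm : orders ι B = m) (z : ℂ)
    (C : ∀ j, SmoothSections I F V →ₗ[ℂ] SmoothSections J (G j) (W j)) :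
    poissonOp 𝔞 𝔟 ι r A B z ∘L boundaryExt 𝔞 𝔟 r (orders ι B) C =
      (problemOfOrders 𝔞 𝔟 r m A B z).inverse ∘L ContinuousLinearMap.inr ℂ _ _ ∘L
        boundaryExt 𝔞 𝔟 r m C := by
  subst hm; rfl

theorem bijective_problemOfOrders {m : Fin k → ℕ} (hm : orders ι B = m) {z : ℂ}
    (h : Function.Bijective (problem 𝔞 𝔟 ι r A B z)) :
    Function.Bijective (problemOfOrders 𝔞 𝔟 r m A B z) := by
  subst hm; exact h

theorem hasDerivAt_resolventOp_interp {m : Fin k → ℕ} {t : ℝ} {z : ℂ}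
    (hm : ∀ᶠ τ in 𝓝 t, orders ι (interp B₀ B₁ τ) = m)
    (ht : IsBoundedBoundaryOp 𝔞 𝔟 r m (interp B₀ B₁ t))
    (hB : IsBoundedBoundaryOp 𝔞 𝔟 r m (B₁ - B₀))
    (hbij : Function.Bijective (problem 𝔞 𝔟 ι r A (interp B₀ B₁ t) z)) :
    HasDerivAt (fun τ : ℝ => resolventOp 𝔞 𝔟 ι r A (interp B₀ B₁ τ) z)
      (-(poissonOp 𝔞 𝔟 ι r A (interp B₀ B₁ t) z ∘L
        boundaryExt 𝔞 𝔟 r (orders ι (interp B₀ B₁ t)) (B₁ - B₀) ∘L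
          resolventOp 𝔞 𝔟 ι r A (interp B₀ B₁ t) z)) t := by
  have hmt := hm.self_of_nhds
  set T := problemOfOrders 𝔞 𝔟 r m A (interp B₀ B₁ t) z with hTdef
  set S : SobolevSpace 𝔞 r →L[ℂ] SobolevSpace 𝔞 0 × BoundaryData 𝔟 r m :=
    ContinuousLinearMap.inr ℂ _ _ ∘L boundaryExt 𝔞 𝔟 r m (B₁ - B₀) with hS
  have hcurve : ∀ τ : ℝ, problemOfOrders 𝔞 𝔟 r m A (interp B₀ B₁ τ) z = T + ((τ : ℂ) - t) • S := by
    intro τ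
    rw [problemOfOrders, interp_eq_add_smul B₀ B₁ t τ, boundaryExt_add_smul _ ht hB]
    ext u <;> simp [hTdef, hS, problemOfOrders]
  -- `HasDerivAt.clm_inverse` needs a parameter in the scalar field `ℂ`; the affine path is
  -- complexified and later restricted to `ℝ`.
  have hT : HasDerivAt (fun ζ : ℂ => T + (ζ - t) • S) S t := by
    simpa using (((hasDerivAt_id (t : ℂ)).sub_const (t : ℂ)).smul_const S).const_add T
  have hinv : (T + ((t : ℂ) - t) • S).IsInvertible := by
    rw [sub_self, zero_smul, add_zero]
    exact ContinuousLinearMap.isInvertible_of_bijective (bijective_problemOfOrders hmt hbij)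
  have h := ((hT.clm_inverse hinv).clm_comp (hasDerivAt_const (t : ℂ)
    (ContinuousLinearMap.inl ℂ (SobolevSpace 𝔞 0) (BoundaryData 𝔟 r m)))).scomp t
      Complex.ofRealCLM.hasDerivAt
  refine (h.congr_of_eventuallyEq ?_).congr_deriv ?_
  · filter_upwards [hm] with τ hτ
    rw [resolventOp_eq hτ, hcurve]
    rfl
  -- Rebracketing groups `P B'`, hiding the order-dependent space before the orders are replaced.
  · rw [← ContinuousLinearMap.comp_assoc (poissonOp _ _ _ _ _ _ _),
      poissonOp_comp_boundaryExt_eq hmt, resolventOp_eq hmt, ← hTdef]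
    ext u
    simp [hS]

end Problem

end BVP

/-! ### The theorem -/

theorem mainTheorem5
    {n : ℕ} (hn : 1 ≤ n)
    {M : Type*} [TopologicalSpace M] [ChartedSpace (EuclideanHalfSpace (n + 1)) M]
    [CompactSpace M] [T2Space M] [IsManifold (𝓡∂ (n + 1)) ∞ M]
    {N : Type*} [TopologicalSpace N] [ChartedSpace (EuclideanSpace ℝ (Fin n)) N]
    [CompactSpace N] [T2Space N] [Nonempty N] [IsManifold (𝓡 n) ∞ N]
    (ι : C^∞⟮𝓡 n, N; 𝓡∂ (n + 1), M⟯)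
    (hι : IsSmoothEmbedding (𝓡 n) (𝓡∂ (n + 1)) ∞ ι)
    (hrange : range ι = (𝓡∂ (n + 1)).boundary M)
    {F : Type*} [NormedAddCommGroup F] [NormedSpace ℂ F] [FiniteDimensional ℂ F]
    {V : M → Type*} [TopologicalSpace (TotalSpace F V)] [∀ x, TopologicalSpace (V x)]
    [∀ x, AddCommGroup (V x)] [∀ x, Module ℂ (V x)] [FiberBundle F V] [VectorBundle ℝ F V]
    [VectorBundle ℂ F V] [ContMDiffVectorBundle ∞ F V (𝓡∂ (n + 1))]
    {k : ℕ} {G : Fin k → Type*} [∀ j, NormedAddCommGroup (G j)] [∀ j, NormedSpace ℂ (G j)]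
    [∀ j, FiniteDimensional ℂ (G j)]
    {W : ∀ _ : Fin k, N → Type*} [∀ j, TopologicalSpace (TotalSpace (G j) (W j))]
    [∀ j x, TopologicalSpace (W j x)] [∀ j x, AddCommGroup (W j x)] [∀ j x, Module ℂ (W j x)]
    [∀ j, FiberBundle (G j) (W j)] [∀ j, VectorBundle ℝ (G j) (W j)]
    [∀ j, VectorBundle ℂ (G j) (W j)] [∀ j, ContMDiffVectorBundle ∞ (G j) (W j) (𝓡 n)]
    (𝔞 : BVP.SobolevAtlas (𝓡∂ (n + 1)) F V) (𝔟 : ∀ j, BVP.SobolevAtlas (𝓡 n) (G j) (W j))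
    {r : ℕ} (hr : 0 < r)
    (A : BVP.SmoothSections (𝓡∂ (n + 1)) F V →ₗ[ℂ] BVP.SmoothSections (𝓡∂ (n + 1)) F V)
    (hA : BVP.IsDiffOp ContMDiffMap.id r A)
    (B₀ B₁ : ∀ j, BVP.SmoothSections (𝓡∂ (n + 1)) F V →ₗ[ℂ] BVP.SmoothSections (𝓡 n) (G j) (W j))
    (hB₀ : ∀ j, ∃ m, BVP.IsDiffOp ι m (B₀ j)) (hB₁ : ∀ j, ∃ m, BVP.IsDiffOp ι m (B₁ j))
    (hord : ∀ j, BVP.diffOrder ι (B₀ j) < BVP.diffOrder ι (B₁ j))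
    (hordr : ∀ j, BVP.diffOrder ι (B₁ j) < r)
    (hinv : ∀ t ∈ Icc (0 : ℝ) 1,
      Function.Bijective (BVP.problem 𝔞 𝔟 ι r A (BVP.interp B₀ B₁ t) 0)) :
    (∀ t ∈ Icc (0 : ℝ) 1, ∀ z ∉ BVP.realizationSpectrum 𝔞 𝔟 ι r A (BVP.interp B₀ B₁ t),
      Function.Bijective (BVP.problem 𝔞 𝔟 ι r A (BVP.interp B₀ B₁ t) z)) ∧
    (∀ t ∈ Ioc (0 : ℝ) 1, ∀ z ∉ BVP.realizationSpectrum 𝔞 𝔟 ι r A (BVP.interp B₀ B₁ t),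
      HasDerivAt (fun τ : ℝ => BVP.resolventOp 𝔞 𝔟 ι r A (BVP.interp B₀ B₁ τ) z)
        (-(BVP.poissonOp 𝔞 𝔟 ι r A (BVP.interp B₀ B₁ t) z ∘L
          BVP.boundaryExt 𝔞 𝔟 r (BVP.orders ι (BVP.interp B₀ B₁ t)) (B₁ - B₀) ∘L
            BVP.resolventOp 𝔞 𝔟 ι r A (BVP.interp B₀ B₁ t) z)) t) ∧
    (∀ t ∈ Icc (0 : ℝ) 1, ∀ z ∉ BVP.realizationSpectrum 𝔞 𝔟 ι r A (BVP.interp B₀ B₁ t),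
      HasDerivAt (fun ζ : ℂ => BVP.poissonOp 𝔞 𝔟 ι r A (BVP.interp B₀ B₁ t) ζ)
        (BVP.resolventOp 𝔞 𝔟 ι r A (BVP.interp B₀ B₁ t) z ∘L BVP.inclL2 𝔞 r ∘L
          BVP.poissonOp 𝔞 𝔟 ι r A (BVP.interp B₀ B₁ t) z) z) := by
  have hbij : ∀ t ∈ Icc (0 : ℝ) 1,
      ∀ z ∉ BVP.realizationSpectrum 𝔞 𝔟 ι r A (BVP.interp B₀ B₁ t),
      Function.Bijective (BVP.problem 𝔞 𝔟 ι r A (BVP.interp B₀ B₁ t) z) := fun t ht z hz =>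
    BVP.bijective_problem_of_notMem_realizationSpectrum (hinv t ht) hz
  refine ⟨hbij, fun t ht z hz => ?_, fun t ht z hz => BVP.hasDerivAt_poissonOp (hbij t ht z hz)⟩
  have hbdd : ∀ s ∈ Ioc (0 : ℝ) 1,
      BVP.IsBoundedBoundaryOp 𝔞 𝔟 r (BVP.orders ι B₁) (BVP.interp B₀ B₁ s) := by
    intro s hs
    rw [← BVP.orders_interp hB₀ hB₁ hord hs.1.ne']
    exact BVP.isBoundedBoundaryOp_of_bijective_problem (hinv s (Ioc_subset_Icc_self hs))
  -- The second point for the difference quotient must be nonzero: at `0` the order drops and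
  -- continuity refers to other boundary spaces.
  have ht₂ : t / 2 ∈ Ioc (0 : ℝ) 1 := ⟨half_pos ht.1, (half_le_self ht.1.le).trans ht.2⟩
  refine BVP.hasDerivAt_resolventOp_interp ?_ (hbdd t ht)
    (BVP.isBoundedBoundaryOp_sub (half_lt_self ht.1).ne (hbdd _ ht₂) (hbdd t ht))
    (hbij t (Ioc_subset_Icc_self ht) z hz)
  -- Constancy of the orders on `τ ≠ 0` gives a two-sided neighbourhood even at `t = 1`.
  filter_upwards [eventually_ne_nhds ht.1.ne'] with τ hτ
  exact BVP.orders_interp hB₀ hB₁ hord hτ
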